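/- Let $N$ be an odd perfect number, that is, an odd positive integer whose positive divisors sum to $2N$. Let $\omega(N)$ denote the number of distinct prime factors of $N$ and $\Omega(N)$ the total number of prime factors of $N$, counted with multiplicity. 1. If $3 \nmid N$, then $$\Omega(N) \ge \frac{302}{113}\,\omega(N) - \frac{286}{113}.$$ 2. If $3 \mid N$, then $$\Omega(N) \ge \frac{66}{25}\,\omega(N) - 5.$$ -/

import Mathlib

/-! Only primes of exponent at most 2 keep `Ω` small against `ω`. If `p ≠ 3` divides `N` exactly
twice, then `p² + p + 1` divides `σ(N) = 2N`, and its prime factors other than 3 are 1 mod 3. So the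
factors of all the `redSigma p` must be absorbed by `targetPrimes N`, which omits the exponent-2
primes that are 2 mod 3. At most one exponent in `N` is odd, so target exponents other than 2 are at
least 4, with one exception. A target of exponent 2 is 1 mod 3 and pays with a factor 3 of `N`.

This is weak when many `redSigma p` have few prime factors, and three facts limit that. If `p` is 2
mod 3 and `redSigma p` has at most two prime factors, one of them exceeds `p` and determines `p`
within its class (`card_filter_cardFactors_le_two`). A `redSigma p` with two prime factors is not a
product of two values from `redSigmaPrimes N` (`redSigma_ne_mul`), so it uses up a target outside
that set. When `3 ∤ N` the same holds for three factors (`sigmaSq_ne_mul_mul`).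

All these constraints are linear in the numbers of `p` sorted by residue mod 3 and number of
factors, and both bounds are linear combinations of them. -/

/-! ### Prime factors of `p² + p + 1` -/

/-- The divisor sum `1 + p + p ^ 2` of the square of a prime `p`. -/
def sigmaSq (p : ℕ) : ℕ := p ^ 2 + p + 1

lemma sigmaSq_strictMono : StrictMono sigmaSq := by
  intro a b h
  unfold sigmaSq
  have : a ^ 2 < b ^ 2 := Nat.pow_lt_pow_left h (by norm_num)
  omega

lemma sigmaSq_pos (p : ℕ) : 0 < sigmaSq p := Nat.succ_pos _

lemma odd_sigmaSq (p : ℕ) : Odd (sigmaSq p) := by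
  have h : sigmaSq p = p * (p + 1) + 1 := by unfold sigmaSq; ring
  rw [h]
  exact (Nat.even_mul_succ_self p).add_one

/-- The difference of the two values factors as `(p - y)(p + y + 1)`: modulo `b` the roots are `y`
and `-1 - y`. -/
lemma prime_dvd_sub_or_add {b p y : ℕ} (hb : b.Prime) (hp : b ∣ sigmaSq p)
    (hy : b ∣ sigmaSq y) : (b : ℤ) ∣ p - y ∨ (b : ℤ) ∣ p + y + 1 := by
  have h : (b : ℤ) ∣ (p - y) * (p + y + 1) := by
    have h1 : (b : ℤ) ∣ (sigmaSq p : ℤ) - sigmaSq y :=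
      dvd_sub (Int.natCast_dvd_natCast.2 hp) (Int.natCast_dvd_natCast.2 hy)
    convert h1 using 1
    unfold sigmaSq
    push_cast
    ring
  exact (Nat.prime_iff_prime_int.1 hb).dvd_or_dvd h

lemma sigmaSq_mod_three_of_mod_eq_one {p : ℕ} (h : p % 3 = 1) : 3 ∣ sigmaSq p := by
  obtain ⟨t, rfl⟩ : ∃ t, p = 3 * t + 1 := ⟨p / 3, by omega⟩
  exact ⟨3 * t ^ 2 + 3 * t + 1, by unfold sigmaSq; ring⟩

lemma sigmaSq_div_three_mod {p : ℕ} (h : p % 3 = 1) : (sigmaSq p / 3) % 3 = 1 := by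
  obtain ⟨t, rfl⟩ : ∃ t, p = 3 * t + 1 := ⟨p / 3, by omega⟩
  have : sigmaSq (3 * t + 1) = 3 * (3 * (t ^ 2 + t) + 1) := by unfold sigmaSq; ring
  rw [this]
  omega

lemma sigmaSq_mod_three_of_mod_eq_two {p : ℕ} (h : p % 3 = 2) : sigmaSq p % 3 = 1 := by
  obtain ⟨t, rfl⟩ : ∃ t, p = 3 * t + 2 := ⟨p / 3, by omega⟩
  have : sigmaSq (3 * t + 2) = 3 * (3 * t ^ 2 + 5 * t + 2) + 1 := by unfold sigmaSq; ring
  rw [this]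
  omega

/-- A root of `X² + X + 1` modulo `r` has order 3 in the unit group, unless it is 1, which forces `r
= 3`. -/
lemma mod_three_of_prime_dvd_sigmaSq {r p : ℕ} (hr : r.Prime) (h : r ∣ sigmaSq p)
    (h3 : r ≠ 3) : r % 3 = 1 := by
  have := Fact.mk hr
  have h0 : ((p : ZMod r)) ^ 2 + p + 1 = 0 := by
    have := (ZMod.natCast_eq_zero_iff (sigmaSq p) r).2 h
    simpa [sigmaSq] using this
  have h1 : (p : ZMod r) ^ 3 = 1 := by linear_combination ((p : ZMod r) - 1) * h0
  have hne : (p : ZMod r) ≠ 1 := by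
    intro h2
    rw [h2] at h0
    have h4 : ((3 : ℕ) : ZMod r) = 0 := by push_cast; linear_combination h0
    rw [ZMod.natCast_eq_zero_iff] at h4
    exact h3 ((Nat.prime_dvd_prime_iff_eq hr Nat.prime_three).1 h4)
  have : Fact (Nat.Prime 3) := ⟨Nat.prime_three⟩
  have h5 : orderOf (p : ZMod r) = 3 := orderOf_eq_prime h1 hne
  have hp0 : (p : ZMod r) ≠ 0 := by
    intro h2
    rw [h2] at h1
    norm_num at h1
  have h6 := ZMod.orderOf_dvd_card_sub_one hp0
  rw [h5] at h6
  have := hr.two_le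
  omega

/-- Among the residues modulo `r` at which `sigmaSq` vanishes, at most one number below `r`
is congruent to `2` modulo `3`. -/
lemma eq_of_prime_dvd_sigmaSq_of_lt {r p q : ℕ} (hr : r.Prime) (hp : r ∣ sigmaSq p)
    (hq : r ∣ sigmaSq q) (hpr : p < r) (hqr : q < r) (hp3 : p % 3 = 2) (hq3 : q % 3 = 2) :
    p = q := by
  have hr3 : r % 3 = 1 := by
    refine mod_three_of_prime_dvd_sigmaSq hr hp ?_
    rintro rfl
    have := sigmaSq_mod_three_of_mod_eq_two hp3
    omega
  rcases prime_dvd_sub_or_add hr hp hq with h | h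
  · have := Int.eq_zero_of_abs_lt_dvd h (by rw [abs_lt]; omega)
    omega
  · obtain ⟨k, hk⟩ := h
    have hk1 : 0 < k := by
      by_contra! hk0
      nlinarith
    have hk2 : k < 2 := by
      by_contra! hk0
      nlinarith
    -- The second root would give `p + q + 1 = r`, but the left side is 2 mod 3 and the right side
    -- 1.
    obtain rfl : k = 1 := by omega
    omega

lemma lt_of_sigmaSq_le_sq {p b : ℕ} (h : sigmaSq p ≤ b ^ 2) : p < b := by
  by_contra! h1
  have : b ^ 2 ≤ p ^ 2 := Nat.pow_le_pow_left h1 2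
  unfold sigmaSq at h
  omega

lemma prime_ne_sq {p : ℕ} (hp : p.Prime) (y : ℕ) : p ≠ y ^ 2 := by
  rintro rfl
  exact Nat.Prime.not_prime_pow le_rfl hp

/-- Such a `z` lies strictly between `x` and `2x`, so `z - x` and `z + x + 1` are positive and too
small to be multiples of `sigmaSq x`. -/
lemma sigmaSq_ne_three_mul {x z : ℕ} (hx : 3 ≤ x) (hxp : (sigmaSq x).Prime) :
    sigmaSq z ≠ 3 * sigmaSq x := by
  intro h
  have hzx : z < 2 * x := by
    unfold sigmaSq at h
    by_contra! h1
    nlinarith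
  have hxz : x < z := by
    unfold sigmaSq at h
    by_contra! h1
    nlinarith
  have hs : (sigmaSq x : ℤ) = x ^ 2 + x + 1 := by unfold sigmaSq; push_cast; ring
  rcases prime_dvd_sub_or_add hxp ⟨3, by rw [h]; ring⟩ dvd_rfl with h1 | h1
  · have := Int.eq_zero_of_abs_lt_dvd h1 (by rw [abs_lt]; constructor <;> nlinarith)
    omega
  · obtain ⟨k, hk⟩ := h1
    have hk1 : 0 < k := by
      by_contra! hk0
      nlinarith
    have hz : (z : ℤ) ≥ x ^ 2 := by nlinarith
    have : (z : ℤ) < 2 * x := by exact_mod_cast hzx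
    nlinarith

/-- If the prime `sigmaSq y` is the larger of two prime factors of `sigmaSq p`, then `p` is a
square. -/
lemma eq_or_eq_sq_of_dvd {p y : ℕ} (hy : (sigmaSq y).Prime) (h : sigmaSq y ∣ sigmaSq p)
    (hlt : p < sigmaSq y) : p = y ∨ p = y ^ 2 := by
  have hs : (sigmaSq y : ℤ) = y ^ 2 + y + 1 := by unfold sigmaSq; push_cast; ring
  have hlt' : (p : ℤ) < sigmaSq y := by exact_mod_cast hlt
  rcases prime_dvd_sub_or_add hy h dvd_rfl with h1 | h1
  · left
    have := Int.eq_zero_of_abs_lt_dvd h1 (by rw [abs_lt]; constructor <;> nlinarith)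
    omega
  · right
    obtain ⟨k, hk⟩ := h1
    have hk1 : 0 < k := by
      by_contra! hk0
      nlinarith
    have hk2 : k < 2 := by
      by_contra! hk0
      nlinarith
    obtain rfl : k = 1 := by omega
    have : (p : ℤ) = (y : ℤ) ^ 2 := by linarith
    exact_mod_cast this

/-! ### The reduced divisor sum and its prime values -/

/-- The reduced divisor sum: `sigmaSq p` with its possible factor `3` removed. -/
def redSigma (p : ℕ) : ℕ := if p % 3 = 1 then sigmaSq p / 3 else sigmaSq p

lemma redSigma_of_one {p : ℕ} (h : p % 3 = 1) : sigmaSq p = 3 * redSigma p := by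
  have := sigmaSq_mod_three_of_mod_eq_one h
  rw [redSigma, if_pos h]
  omega

lemma redSigma_of_two {p : ℕ} (h : p % 3 = 2) : sigmaSq p = redSigma p := by
  rw [redSigma, if_neg (by omega)]

lemma redSigma_dvd (p : ℕ) : redSigma p ∣ sigmaSq p := by
  by_cases h : p % 3 = 1
  · exact ⟨3, by rw [redSigma_of_one h]; ring⟩
  · rw [redSigma, if_neg h]

lemma redSigma_mod_three {p : ℕ} (h : p % 3 ≠ 0) : redSigma p % 3 = 1 := by
  by_cases h1 : p % 3 = 1
  · rw [redSigma, if_pos h1]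
    exact sigmaSq_div_three_mod h1
  · rw [redSigma, if_neg h1]
    exact sigmaSq_mod_three_of_mod_eq_two (by omega)

/-- `redSigma` takes prime values injectively. -/
lemma redSigma_inj {x y : ℕ} (hx : 3 ≤ x) (hy : 3 ≤ y) (hx3 : x % 3 ≠ 0) (hy3 : y % 3 ≠ 0)
    (hxp : (redSigma x).Prime) (h : redSigma x = redSigma y) : x = y := by
  have h1 : x % 3 = 1 ∨ x % 3 = 2 := by omega
  have h2 : y % 3 = 1 ∨ y % 3 = 2 := by omega
  rcases h1 with h1 | h1 <;> rcases h2 with h2 | h2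
  · apply sigmaSq_strictMono.injective
    rw [redSigma_of_one h1, redSigma_of_one h2, h]
  · have h4 := redSigma_of_one h1
    have h5 := redSigma_of_two h2
    rw [h, ← h5] at h4
    exact absurd h4 (sigmaSq_ne_three_mul hy (by rw [h5, ← h]; exact hxp))
  · have h4 := redSigma_of_one h2
    have h5 := redSigma_of_two h1
    rw [← h, ← h5] at h4
    exact absurd h4 (sigmaSq_ne_three_mul hx (by rw [h5]; exact hxp))
  · apply sigmaSq_strictMono.injective
    rw [redSigma_of_two h1, redSigma_of_two h2, h]

lemma redSigma_of_one_expand (t : ℕ) : redSigma (3 * t + 1) = 3 * t ^ 2 + 3 * t + 1 := by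
  have h := redSigma_of_one (p := 3 * t + 1) (by omega)
  have : sigmaSq (3 * t + 1) = 3 * (3 * t ^ 2 + 3 * t + 1) := by unfold sigmaSq; ring
  omega

/-! ### Products of two prime values -/

/-- The ordered form of `redSigma_ne_mul` for `p ≡ 2 (mod 3)`. -/
lemma sigmaSq_ne_mul_of_two {p x y : ℕ} (hp : p.Prime) (hp3 : p % 3 = 2)
    (hx : 5 ≤ x) (hy : 5 ≤ y) (hxo : Odd x) (hyo : Odd y)
    (hx3 : x % 3 ≠ 0) (hy3 : y % 3 ≠ 0)
    (hxp : (redSigma x).Prime) (hyp : (redSigma y).Prime)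
    (hle : redSigma x ≤ redSigma y) : redSigma p ≠ redSigma x * redSigma y := by
  intro h
  rw [← redSigma_of_two hp3] at h
  have hlt : p < redSigma y := lt_of_sigmaSq_le_sq (by rw [h]; nlinarith)
  have hdvd : redSigma y ∣ sigmaSq p := ⟨redSigma x, by rw [h]; ring⟩
  have h2 : y % 3 = 1 ∨ y % 3 = 2 := by omega
  rcases h2 with h2 | h2
  · obtain ⟨t, rfl⟩ : ∃ t, y = 3 * t + 1 := ⟨y / 3, by omega⟩
    have hb := redSigma_of_one_expand t
    have hb' : (redSigma (3 * t + 1) : ℤ) = 3 * (t : ℤ) ^ 2 + 3 * t + 1 := by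
      rw [hb]; push_cast; ring
    have ht : 2 ≤ t := by omega
    have hlt' : (p : ℤ) < redSigma (3 * t + 1) := by exact_mod_cast hlt
    have ht' : (2 : ℤ) ≤ t := by exact_mod_cast ht
    rcases prime_dvd_sub_or_add hyp hdvd (redSigma_dvd _) with h1 | h1
    · have := Int.eq_zero_of_abs_lt_dvd h1
        (by rw [abs_lt]; push_cast; constructor <;> nlinarith)
      omega
    · obtain ⟨k, hk⟩ := h1
      push_cast at hk
      have hk1 : 0 < k := by
        by_contra! hk0
        nlinarith
      have hk2 : k < 2 := by
        by_contra! hk0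
        nlinarith
      obtain rfl : k = 1 := by omega
      obtain ⟨w, rfl⟩ : ∃ w, t = w + 1 := ⟨t - 1, by omega⟩
      -- With `t = w + 1`, `sigmaSq (3t² - 1) = (3t² - 3t + 1)(3t² + 3t + 1)`. The cofactor is the
      -- value at `y - 3`, so injectivity gives `x = y - 3`, against both being odd.
      have hpe : (p : ℤ) = 3 * (w + 1 : ℤ) ^ 2 - 1 := by push_cast at hk hb'; linarith
      have hw := redSigma_of_one_expand w
      have hfac : (sigmaSq p : ℤ) = redSigma (3 * w + 1) * redSigma (3 * (w + 1) + 1) := by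
        rw [hb', hw]
        unfold sigmaSq
        push_cast
        rw [hpe]
        ring
      have hxw : redSigma x = redSigma (3 * w + 1) := by
        have h7 : redSigma x * redSigma (3 * (w + 1) + 1)
            = redSigma (3 * w + 1) * redSigma (3 * (w + 1) + 1) := by
          rw [← h]; exact_mod_cast hfac
        exact Nat.eq_of_mul_eq_mul_right hyp.pos h7
      have hxe := redSigma_inj (by omega) (by omega) hx3 (by omega) hxp hxw
      rw [Nat.odd_iff] at hxo hyo
      omega
  · rw [← redSigma_of_two h2] at hyp hdvd hlt
    rcases eq_or_eq_sq_of_dvd hyp hdvd hlt with h3 | h3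
    · rw [h3, ← redSigma_of_two h2] at h
      have := hxp.two_le
      have := sigmaSq_pos y
      nlinarith
    · exact prime_ne_sq hp y h3

/-- The ordered form of `redSigma_ne_mul` for `p ≡ 1 (mod 3)`. -/
lemma sigmaSq_ne_mul_of_one {p x y : ℕ} (hp : p.Prime) (hp3 : p % 3 = 1)
    (hy : 5 ≤ y) (hy3 : y % 3 ≠ 0)
    (hxp : (redSigma x).Prime) (hyp : (redSigma y).Prime)
    (hle : redSigma x ≤ redSigma y) : redSigma p ≠ redSigma x * redSigma y := by
  intro h
  have hs := redSigma_of_one hp3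
  rw [h] at hs
  have hdvd : redSigma y ∣ sigmaSq p := ⟨3 * redSigma x, by rw [hs]; ring⟩
  have hub : sigmaSq p ≤ 3 * redSigma y ^ 2 := by rw [hs]; nlinarith
  have hlt : p < 2 * redSigma y := by
    unfold sigmaSq at hub
    by_contra! h1
    nlinarith
  have hlt' : (p : ℤ) < 2 * redSigma y := by exact_mod_cast hlt
  have hy' : (5 : ℤ) ≤ y := by exact_mod_cast hy
  have hpy : p ≠ y := by
    rintro rfl
    have := hxp.two_le
    have := hyp.two_le
    nlinarith
  have h2 : y % 3 = 1 ∨ y % 3 = 2 := by omega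
  rcases h2 with h2 | h2
  · have hb3 := redSigma_mod_three hy3
    have hb := redSigma_of_one h2
    have hb' : (3 * redSigma y : ℤ) = y ^ 2 + y + 1 := by
      have : sigmaSq y = y ^ 2 + y + 1 := rfl
      rw [this] at hb
      exact_mod_cast hb.symm
    -- Both `p - y` and `p + y + 1` are multiples of 3 and `redSigma y` is not, so they are in fact
    -- multiples of `3 * redSigma y = sigmaSq y`.
    have key : ∀ k : ℤ, (3 : ℤ) ∣ redSigma y * k → (3 : ℤ) ∣ k := by
      intro k hk
      refine (Int.prime_three.dvd_or_dvd hk).resolve_left ?_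
      omega
    rcases prime_dvd_sub_or_add hyp hdvd (redSigma_dvd _) with ⟨k, hk⟩ | ⟨k, hk⟩
    · obtain ⟨j, rfl⟩ := key k (by rw [← hk]; omega)
      have hj1 : j < 1 := by
        by_contra! hk0
        nlinarith
      have hj2 : -1 < j := by
        by_contra! hk0
        nlinarith
      obtain rfl : j = 0 := by omega
      simp at hk
      omega
    · obtain ⟨j, rfl⟩ := key k (by rw [← hk]; omega)
      have hj1 : 0 < j := by
        by_contra! hk0
        nlinarith
      have hj2 : j < 2 := by
        by_contra! hk0
        nlinarith
      obtain rfl : j = 1 := by omega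
      have : (p : ℤ) = (y : ℤ) ^ 2 := by linarith
      exact prime_ne_sq hp y (by exact_mod_cast this)
  · have hb' : (redSigma y : ℤ) = y ^ 2 + y + 1 := by
      rw [← redSigma_of_two h2]
      unfold sigmaSq
      push_cast
      ring
    rcases prime_dvd_sub_or_add hyp hdvd (redSigma_dvd _) with ⟨k, hk⟩ | ⟨k, hk⟩
    · have hk1 : k < 2 := by
        by_contra! hk0
        nlinarith
      have hk2 : -1 < k := by
        by_contra! hk0
        nlinarith
      obtain rfl | rfl : k = 0 ∨ k = 1 := by omega
      · simp at hk
        omega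
      · have : (p : ℤ) = ((y + 1 : ℕ) : ℤ) ^ 2 := by push_cast; linarith
        exact prime_ne_sq hp (y + 1) (by exact_mod_cast this)
    · have hk1 : 0 < k := by
        by_contra! hk0
        nlinarith
      have hk2 : k < 3 := by
        by_contra! hk0
        nlinarith
      obtain rfl | rfl : k = 1 ∨ k = 2 := by omega
      · have : (p : ℤ) = (y : ℤ) ^ 2 := by linarith
        exact prime_ne_sq hp y (by exact_mod_cast this)
      -- The one candidate that is not a square is excluded by size: `p²` is about `4y⁴`, above `3 *
      -- redSigma y ^ 2`.
      · have hpe : (p : ℤ) = 2 * y ^ 2 + y + 1 := by linarith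
        have hub' : (p : ℤ) ^ 2 + p + 1 ≤ 3 * (redSigma y : ℤ) ^ 2 := by
          unfold sigmaSq at hub; exact_mod_cast hub
        rw [hb', hpe] at hub'
        have : (0 : ℤ) < y ^ 3 * (y - 5) + 1 := by
          have : (0 : ℤ) ≤ y ^ 3 * (y - 5) := mul_nonneg (by positivity) (by linarith)
          linarith
        nlinarith [mul_nonneg (sq_nonneg (y : ℤ)) (by linarith : (0 : ℤ) ≤ y - 5)]

lemma redSigma_ne_mul {p x y : ℕ} (hp : p.Prime) (hp3 : p % 3 ≠ 0)
    (hx : 5 ≤ x) (hy : 5 ≤ y) (hxo : Odd x) (hyo : Odd y)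
    (hx3 : x % 3 ≠ 0) (hy3 : y % 3 ≠ 0)
    (hxp : (redSigma x).Prime) (hyp : (redSigma y).Prime) :
    redSigma p ≠ redSigma x * redSigma y := by
  have h : p % 3 = 1 ∨ p % 3 = 2 := by omega
  rcases h with h | h <;> rcases le_total (redSigma x) (redSigma y) with hle | hle
  · exact sigmaSq_ne_mul_of_one hp h hy hy3 hxp hyp hle
  · rw [mul_comm]
    exact sigmaSq_ne_mul_of_one hp h hx hx3 hyp hxp hle
  · exact sigmaSq_ne_mul_of_two hp h hx hy hxo hyo hx3 hy3 hxp hyp hle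
  · rw [mul_comm]
    exact sigmaSq_ne_mul_of_two hp h hy hx hyo hxo hy3 hx3 hyp hxp hle

/-! ### Products of three prime values -/

/-- If `sigmaSq y` is the larger factor of `X ^ 2 + m * X + m ^ 2 = sigmaSq x * sigmaSq y`, with
`X` close to a multiple of `m`, then `X + m * y + m` is `sigmaSq y` or `2 * sigmaSq y`. -/
lemma add_eq_mul_of_quadratic_eq {x y z : ℕ} {X m ε : ℤ} (hyp : (sigmaSq y).Prime)
    (hy5 : 5 ≤ y) (hxy : x ≤ y) (hyz : y ≤ z) (hm : 2 ≤ m) (hε : ε = 1 ∨ ε = -1)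
    (hX : X = m * z + ε) (hf : X ^ 2 + m * X + m ^ 2 = sigmaSq x * sigmaSq y) :
    ∃ j : ℤ, 0 < j ∧ j < 3 ∧ X + m * y + m = sigmaSq y * j := by
  have hb : (sigmaSq y : ℤ) = y ^ 2 + y + 1 := by unfold sigmaSq; push_cast; ring
  have hab : (sigmaSq x : ℤ) ≤ sigmaSq y := by
    exact_mod_cast sigmaSq_strictMono.monotone hxy
  have hy5' : (5 : ℤ) ≤ y := by exact_mod_cast hy5
  have hyz' : (y : ℤ) ≤ z := by exact_mod_cast hyz
  have hbpos : (0 : ℤ) < sigmaSq y := by exact_mod_cast hyp.pos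
  have hmy : m * y ≤ m * z := by nlinarith
  have hm5 : 5 * m ≤ m * y := by nlinarith
  have hε1 : -1 ≤ ε := by rcases hε with h | h <;> omega
  have hε2 : ε ≤ 1 := by rcases hε with h | h <;> omega
  have hXpos : 0 < X := by linarith
  have hXb : X < sigmaSq y := by
    have : X ^ 2 < (sigmaSq y : ℤ) ^ 2 := by nlinarith
    exact lt_of_pow_lt_pow_left₀ 2 hbpos.le this
  -- `(X - my)(X + my + m) = (X² + mX + m²) - m² * sigmaSq y`.
  have hdvd : (sigmaSq y : ℤ) ∣ (X - m * y) * (X + m * y + m) :=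
    ⟨sigmaSq x - m ^ 2, by rw [hb] at hf ⊢; linear_combination hf⟩
  rcases (Nat.prime_iff_prime_int.1 hyp).dvd_or_dvd hdvd with h | ⟨j, hj⟩
  · exfalso
    have h0 : X - m * y = 0 :=
      Int.eq_zero_of_abs_lt_dvd h (by rw [abs_lt]; constructor <;> nlinarith)
    have h1 : m ∣ 1 := by
      have : m * (y - z) = ε := by linarith
      rcases hε with h2 | h2
      · exact ⟨y - z, by linarith⟩
      · exact ⟨z - y, by linarith⟩
    have := Int.le_of_dvd one_pos h1
    omega
  · refine ⟨j, ?_, ?_, hj⟩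
    · by_contra! hk0
      nlinarith
    · by_contra! hk0
      nlinarith

/-- For `p ≡ 2 (mod 3)`, `sigmaSq p` is not a product of three primes that are themselves of the
form `sigmaSq q` with `q ≡ 2 (mod 3)`. -/
lemma sigmaSq_ne_mul_mul_of_le {p x y z : ℕ} (hp3 : p % 3 = 2)
    (hx : x.Prime) (hy : y.Prime) (hz : z.Prime)
    (hx3 : x % 3 = 2) (hy3 : y % 3 = 2) (hz3 : z % 3 = 2) (hy5 : 5 ≤ y)
    (hyp : (sigmaSq y).Prime) (hzp : (sigmaSq z).Prime)
    (hxy : x ≤ y) (hyz : y ≤ z) : sigmaSq p ≠ sigmaSq x * sigmaSq y * sigmaSq z := by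
  intro h
  have ha : (sigmaSq x : ℤ) = x ^ 2 + x + 1 := by unfold sigmaSq; push_cast; ring
  have hb : (sigmaSq y : ℤ) = y ^ 2 + y + 1 := by unfold sigmaSq; push_cast; ring
  have hc : (sigmaSq z : ℤ) = z ^ 2 + z + 1 := by unfold sigmaSq; push_cast; ring
  have hb3 := sigmaSq_mod_three_of_mod_eq_two hy3
  have hc3 := sigmaSq_mod_three_of_mod_eq_two hz3
  have hcpos : (0 : ℤ) < sigmaSq z := by exact_mod_cast hzp.pos
  have hc0 : (sigmaSq z : ℤ) ≠ 0 := hcpos.ne'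
  have hpe : (p : ℤ) ^ 2 + p + 1 = sigmaSq x * sigmaSq y * sigmaSq z := by
    have h' := h
    rw [sigmaSq] at h'
    exact_mod_cast h'
  have hzp' : z < p := by
    apply sigmaSq_strictMono.lt_iff_lt.1
    have h1 := hyp.two_le
    have h2 := sigmaSq_pos x
    have h3 := hzp.pos
    rw [h]
    nlinarith [Nat.mul_le_mul h2 h1]
  have hdvd : sigmaSq z ∣ sigmaSq p := ⟨sigmaSq x * sigmaSq y, by rw [h]; ring⟩
  have mod_mul (m : ℤ) : (sigmaSq z * m) % 3 = m % 3 := by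
    have : (sigmaSq z : ℤ) % 3 = 1 := by omega
    rw [Int.mul_emod, this]
    simp
  have mod_mul' (m : ℤ) : (sigmaSq y * m) % 3 = m % 3 := by
    have : (sigmaSq y : ℤ) % 3 = 1 := by omega
    rw [Int.mul_emod, this]
    simp
  rcases prime_dvd_sub_or_add hzp hdvd dvd_rfl with ⟨m, hm⟩ | ⟨m, hm⟩
  · have hm0 : 0 < m := by
      by_contra! h0
      nlinarith
    have hm3 : m % 3 = 0 := by
      rw [← mod_mul, ← hm]
      omega
    obtain ⟨n, rfl⟩ : ∃ n, m = 3 * n := ⟨m / 3, by omega⟩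
    -- Substituting `p = z + m * sigmaSq z` and cancelling `sigmaSq z` leaves a quadratic form in
    -- `mz + 1` and `m`.
    have hf : (3 * n * z + 1) ^ 2 + 3 * n * (3 * n * z + 1) + (3 * n) ^ 2
        = sigmaSq x * sigmaSq y := by
      apply mul_right_cancel₀ hc0
      rw [← hpe]
      have : (p : ℤ) = z + sigmaSq z * (3 * n) := by linarith
      rw [this, hc]
      ring
    obtain ⟨j, hj0, hj3, hj⟩ := add_eq_mul_of_quadratic_eq (ε := 1) hyp hy5 hxy hyz (by omega)
      (Or.inl rfl) rfl hf
    have hj1 : j % 3 = 1 := by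
      rw [← mod_mul', ← hj]
      have : 3 * n * (z : ℤ) + 1 + 3 * n * y + 3 * n = 3 * (n * z + n * y + n) + 1 := by ring
      omega
    obtain rfl : j = 1 := by omega
    have hX : 3 * n * (z : ℤ) + 1 = sigmaSq y - 3 * n * (y + 1) := by linarith
    -- The form is now `sigmaSq y * sigmaSq (y - m)`, so `x = y - m`. Then `(y - x)z = x(y + 1)`,
    -- and the prime `x` must equal `y` or `z`, forcing `m = 0`.
    have hxa : (sigmaSq x : ℤ) = (y - 3 * n) ^ 2 + (y - 3 * n) + 1 := by
      have hb0 : (sigmaSq y : ℤ) ≠ 0 := by exact_mod_cast hyp.ne_zero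
      apply mul_right_cancel₀ hb0
      rw [← hf, hX, hb]
      ring
    have h0 : ((x : ℤ) - (y - 3 * n)) * (x + (y - 3 * n) + 1) = 0 := by
      rw [ha] at hxa
      linear_combination hxa
    rcases mul_eq_zero.1 h0 with h1 | h1
    · have h3n : 3 * n = (y : ℤ) - x := by linarith
      rw [h3n, hb] at hX
      have h2 : ((y : ℤ) - x) * z = x * (y + 1) := by linear_combination hX
      have h3 : (x : ℤ) ∣ (y - x) * z := ⟨y + 1, h2⟩
      have hyx : (x : ℤ) ≤ y := by exact_mod_cast hxy
      have hyz' : (y : ℤ) ≤ z := by exact_mod_cast hyz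
      have hx0 : (0 : ℤ) < x := by exact_mod_cast hx.pos
      rcases (Nat.prime_iff_prime_int.1 hx).dvd_or_dvd h3 with h4 | h4
      · have h5 : (x : ℤ) ∣ y := by
          have := dvd_add h4 (dvd_refl (x : ℤ))
          simpa using this
        have := (Nat.prime_dvd_prime_iff_eq hx hy).1 (by exact_mod_cast h5)
        omega
      · have := (Nat.prime_dvd_prime_iff_eq hx hz).1 (by exact_mod_cast h4)
        omega
    · omega
  · have hm0 : 0 < m := by
      by_contra! h0
      nlinarith
    have hm3 : m % 3 = 2 := by
      rw [← mod_mul, ← hm]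
      omega
    obtain ⟨n, rfl⟩ : ∃ n, m = 3 * n + 2 := ⟨m / 3, by omega⟩
    obtain ⟨w, rfl⟩ : ∃ w, z = 3 * w + 2 := ⟨z / 3, by omega⟩
    obtain ⟨v, rfl⟩ : ∃ v, y = 3 * v + 2 := ⟨y / 3, by omega⟩
    set M : ℤ := 3 * n + 2 with hM
    have hf : (M * (3 * w + 2 : ℕ) + -1) ^ 2 + M * (M * (3 * w + 2 : ℕ) + -1) + M ^ 2
        = sigmaSq x * sigmaSq (3 * v + 2) := by
      apply mul_right_cancel₀ hc0
      rw [← hpe]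
      have : (p : ℤ) = sigmaSq (3 * w + 2) * M - 1 - (3 * w + 2 : ℕ) := by linarith
      rw [this, hc]
      ring
    obtain ⟨j, hj0, hj3, hj⟩ := add_eq_mul_of_quadratic_eq (ε := -1) hyp hy5 hxy hyz (by omega)
      (Or.inr rfl) rfl hf
    -- Here `m`, `y` and `z` are all 2 mod 3, so `m(z + y + 1) - 1` is divisible by 3; no `j` with
    -- `0 < j < 3` is left.
    have hj1 : j % 3 = 0 := by
      rw [← mod_mul', ← hj]
      have : M * ((3 * w + 2 : ℕ) : ℤ) + -1 + M * (3 * v + 2 : ℕ) + M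
          = 3 * (M * (w + v + 1) + 2 * n + 1) := by rw [hM]; push_cast; ring
      omega
    omega

lemma sigmaSq_ne_mul_mul {p x y z : ℕ} (hp3 : p % 3 = 2)
    (hx : x.Prime) (hy : y.Prime) (hz : z.Prime)
    (hx3 : x % 3 = 2) (hy3 : y % 3 = 2) (hz3 : z % 3 = 2)
    (hx5 : 5 ≤ x) (hy5 : 5 ≤ y) (hz5 : 5 ≤ z) (hxp : (sigmaSq x).Prime)
    (hyp : (sigmaSq y).Prime) (hzp : (sigmaSq z).Prime) :
    sigmaSq p ≠ sigmaSq x * sigmaSq y * sigmaSq z := by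
  intro h
  rcases le_total x y with h1 | h1 <;> rcases le_total y z with h2 | h2 <;>
    rcases le_total x z with h3 | h3
  · exact sigmaSq_ne_mul_mul_of_le hp3 hx hy hz hx3 hy3 hz3 hy5 hyp hzp h1 h2 h
  · exact sigmaSq_ne_mul_mul_of_le hp3 hx hy hz hx3 hy3 hz3 hy5 hyp hzp h1 h2 h
  · exact sigmaSq_ne_mul_mul_of_le hp3 hx hz hy hx3 hz3 hy3 hz5 hzp hyp h3 h2 (by rw [h]; ring)
  · exact sigmaSq_ne_mul_mul_of_le hp3 hz hx hy hz3 hx3 hy3 hx5 hxp hyp h3 h1 (by rw [h]; ring)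
  · exact sigmaSq_ne_mul_mul_of_le hp3 hy hx hz hy3 hx3 hz3 hx5 hxp hzp h1 h3 (by rw [h]; ring)
  · exact sigmaSq_ne_mul_mul_of_le hp3 hy hz hx hy3 hz3 hx3 hz5 hzp hxp h2 h3 (by rw [h]; ring)
  · exact sigmaSq_ne_mul_mul_of_le hp3 hz hy hx hz3 hy3 hx3 hy5 hyp hxp h2 h1 (by rw [h]; ring)
  · exact sigmaSq_ne_mul_mul_of_le hp3 hz hy hx hz3 hy3 hx3 hy5 hyp hxp h2 h1 (by rw [h]; ring)

/-! ### Divisibility constraints in an odd perfect number -/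

/-- The prime factors other than `3` that divide `N` exactly twice. -/
def sqPrimes (N : ℕ) : Finset ℕ := {p ∈ N.primeFactors | p ≠ 3 ∧ N.factorization p = 2}

/-- The prime factors other than `3` that can divide some `sigmaSq p`, `p ∈ sqPrimes N`, when `N`
is an odd perfect number. -/
def targetPrimes (N : ℕ) : Finset ℕ :=
  {p ∈ N.primeFactors | p ≠ 3 ∧ ¬ (N.factorization p = 2 ∧ p % 3 = 2)}

/-- The primes of the form `redSigma p` with `p ∈ sqPrimes N`. -/
def redSigmaPrimes (N : ℕ) : Finset ℕ := {p ∈ sqPrimes N | (redSigma p).Prime}.image redSigma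

section OddPerfect

variable {N : ℕ}

lemma mem_sqPrimes {p : ℕ} :
    p ∈ sqPrimes N ↔ p ∈ N.primeFactors ∧ p ≠ 3 ∧ N.factorization p = 2 := by
  simp only [sqPrimes, Finset.mem_filter]

lemma mem_targetPrimes {p : ℕ} : p ∈ targetPrimes N ↔
    p ∈ N.primeFactors ∧ p ≠ 3 ∧ ¬ (N.factorization p = 2 ∧ p % 3 = 2) := by
  simp only [targetPrimes, Finset.mem_filter]

lemma mem_redSigmaPrimes {r : ℕ} : r ∈ redSigmaPrimes N ↔
    ∃ p ∈ sqPrimes N, (redSigma p).Prime ∧ redSigma p = r := by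
  simp only [redSigmaPrimes, Finset.mem_image, Finset.mem_filter, and_assoc]

lemma odd_of_mem_primeFactors (hodd : Odd N) {p : ℕ} (hp : p ∈ N.primeFactors) : Odd p :=
  hodd.of_dvd_nat (Nat.dvd_of_mem_primeFactors hp)

lemma mod_three_ne_zero_of_prime {p : ℕ} (hp : p.Prime) (h3 : p ≠ 3) : p % 3 ≠ 0 := by
  intro h
  exact h3 ((Nat.prime_dvd_prime_iff_eq Nat.prime_three hp).1 (Nat.dvd_of_mod_eq_zero h)).symm

lemma five_le_of_prime {p : ℕ} (hp : p.Prime) (ho : Odd p) (h3 : p ≠ 3) : 5 ≤ p := by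
  have := hp.two_le
  obtain ⟨k, rfl⟩ := ho
  omega

lemma prod_sum_range_of_perfect (hN : N.Perfect) :
    ∏ p ∈ N.primeFactors, ∑ k ∈ Finset.range (N.factorization p + 1), p ^ k = 2 * N := by
  rw [← Nat.sum_divisors hN.2.ne']
  exact (Nat.perfect_iff_sum_divisors_eq_two_mul hN.2).1 hN

lemma even_sum_range_pow {p e : ℕ} (hp : Odd p) (he : Odd e) :
    2 ∣ ∑ k ∈ Finset.range (e + 1), p ^ k := by
  rw [← even_iff_two_dvd, Finset.even_sum_iff_even_card_odd]
  rw [Finset.filter_true_of_mem (fun k _ => hp.pow), Finset.card_range]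
  exact he.add_one

/-- An odd exponent makes `σ(p ^ e)` even; two such primes would give `4 ∣ 2N`. -/
lemma eq_of_odd_factorization (hodd : Odd N) (hN : N.Perfect) {p q : ℕ}
    (hp : p ∈ N.primeFactors) (hq : q ∈ N.primeFactors) (hpe : Odd (N.factorization p))
    (hqe : Odd (N.factorization q)) : p = q := by
  by_contra hne
  have h1 := prod_sum_range_of_perfect hN
  rw [← Finset.mul_prod_erase _ _ hp,
    ← Finset.mul_prod_erase _ _ (Finset.mem_erase.2 ⟨Ne.symm hne, hq⟩)] at h1
  have h2 := even_sum_range_pow (odd_of_mem_primeFactors hodd hp) hpe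
  have h3 := even_sum_range_pow (odd_of_mem_primeFactors hodd hq) hqe
  have h4 : 2 * 2 ∣ 2 * N := by
    rw [← h1, ← mul_assoc]
    exact (mul_dvd_mul h2 h3).trans (dvd_mul_right _ _)
  have h5 : 2 ∣ N := Nat.dvd_of_mul_dvd_mul_left two_pos h4
  rw [Nat.odd_iff] at hodd
  omega

lemma sum_factorization_sigmaSq_le (hN : N.Perfect) {r : ℕ} (hr2 : r ≠ 2) :
    ∑ p ∈ sqPrimes N, (sigmaSq p).factorization r ≤ N.factorization r := by
  have h1 : ∏ p ∈ sqPrimes N, sigmaSq p ∣ 2 * N := by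
    rw [← prod_sum_range_of_perfect hN]
    calc ∏ p ∈ sqPrimes N, sigmaSq p
        = ∏ p ∈ sqPrimes N, ∑ k ∈ Finset.range (N.factorization p + 1), p ^ k := by
          refine Finset.prod_congr rfl fun p hp => ?_
          rw [(mem_sqPrimes.1 hp).2.2]
          simp only [Finset.sum_range_succ, Finset.sum_range_zero, sigmaSq]
          ring
      _ ∣ _ := Finset.prod_dvd_prod_of_subset _ _ _ (Finset.filter_subset _ _)
  have h2N : 2 * N ≠ 0 := by have := hN.2; omega
  have h2 := (Nat.factorization_le_iff_dvd (ne_zero_of_dvd_ne_zero h2N h1) h2N).2 h1 r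
  rw [Nat.factorization_prod fun p _ => (sigmaSq_pos p).ne',
    Nat.factorization_mul two_ne_zero hN.2.ne', Nat.prime_two.factorization] at h2
  simpa [Finsupp.finsetSum_apply, Finsupp.single_apply, hr2.symm] using h2

lemma redSigma_pos (p : ℕ) : 0 < redSigma p :=
  Nat.pos_of_dvd_of_pos (redSigma_dvd p) (sigmaSq_pos p)

lemma mem_targetPrimes_of_dvd (hN : N.Perfect) {p r : ℕ} (hp : p ∈ sqPrimes N)
    (hr : r.Prime) (hrp : r ∣ redSigma p) : r ∈ targetPrimes N := by
  have hd := hrp.trans (redSigma_dvd p)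
  have hr2 : r ≠ 2 := by
    rintro rfl
    have := odd_sigmaSq p
    rw [Nat.odd_iff] at this
    omega
  have hr3 : r ≠ 3 := by
    rintro rfl
    have hpS := mem_sqPrimes.1 hp
    have := redSigma_mod_three
      (mod_three_ne_zero_of_prime (Nat.prime_of_mem_primeFactors hpS.1) hpS.2.1)
    omega
  have h1 : 1 ≤ (sigmaSq p).factorization r :=
    (hr.dvd_iff_one_le_factorization (sigmaSq_pos p).ne').1 hd
  have h2 := Finset.single_le_sum (f := fun p => (sigmaSq p).factorization r)
    (fun _ _ => Nat.zero_le _) hp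
  have h3 := sum_factorization_sigmaSq_le hN hr2
  have h4 := mod_three_of_prime_dvd_sigmaSq hr hd hr3
  refine mem_targetPrimes.2 ⟨?_, hr3, by omega⟩
  rw [← Nat.support_factorization, Finsupp.mem_support_iff]
  omega

lemma factorization_redSigma_le (p r : ℕ) :
    (redSigma p).factorization r ≤ (sigmaSq p).factorization r :=
  (Nat.factorization_le_iff_dvd (redSigma_pos p).ne' (sigmaSq_pos p).ne').2 (redSigma_dvd p) r

lemma ne_two_of_mem_targetPrimes (hodd : Odd N) {r : ℕ} (hr : r ∈ targetPrimes N) : r ≠ 2 := by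
  rintro rfl
  have := odd_of_mem_primeFactors hodd (mem_targetPrimes.1 hr).1
  rw [Nat.odd_iff] at this
  omega

lemma sum_cardFactors_redSigma_le (hodd : Odd N) (hN : N.Perfect) :
    ∑ p ∈ sqPrimes N, ArithmeticFunction.cardFactors (redSigma p)
      ≤ ∑ r ∈ targetPrimes N, N.factorization r := by
  calc ∑ p ∈ sqPrimes N, ArithmeticFunction.cardFactors (redSigma p)
      = ∑ p ∈ sqPrimes N, ∑ r ∈ targetPrimes N, (redSigma p).factorization r := by
        refine Finset.sum_congr rfl fun p hp => ?_
        rw [ArithmeticFunction.cardFactors_eq_sum_factorization, Finsupp.sum,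
          Nat.support_factorization]
        refine Finset.sum_subset (fun r hr => ?_) fun r _ hr => ?_
        · exact mem_targetPrimes_of_dvd hN hp (Nat.prime_of_mem_primeFactors hr)
            (Nat.dvd_of_mem_primeFactors hr)
        · rwa [← Nat.support_factorization, Finsupp.notMem_support_iff] at hr
    _ = ∑ r ∈ targetPrimes N, ∑ p ∈ sqPrimes N, (redSigma p).factorization r :=
        Finset.sum_comm
    _ ≤ _ := by
        refine Finset.sum_le_sum fun r hr => ?_
        exact (Finset.sum_le_sum fun p _ => factorization_redSigma_le p r).trans
          (sum_factorization_sigmaSq_le hN (ne_two_of_mem_targetPrimes hodd hr))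

/-- Double counting: each `p ∈ T` uses up at least one unit of exponent of some prime in `D`. -/
lemma card_le_sum_of_exists_dvd (hodd : Odd N) (hN : N.Perfect) {T D : Finset ℕ}
    (hT : T ⊆ sqPrimes N) (hD : D ⊆ targetPrimes N)
    (h : ∀ p ∈ T, ∃ r ∈ D, r ∣ redSigma p) : T.card ≤ ∑ r ∈ D, N.factorization r := by
  calc T.card = ∑ p ∈ T, 1 := by simp
    _ ≤ ∑ p ∈ T, ∑ r ∈ D, (redSigma p).factorization r := by
        refine Finset.sum_le_sum fun p hp => ?_
        obtain ⟨r, hr, hrp⟩ := h p hp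
        have hrP := Nat.prime_of_mem_primeFactors (mem_targetPrimes.1 (hD hr)).1
        exact ((hrP.dvd_iff_one_le_factorization (redSigma_pos p).ne').1 hrp).trans
          (Finset.single_le_sum (f := fun r => (redSigma p).factorization r)
            (fun _ _ => Nat.zero_le _) hr)
    _ = ∑ r ∈ D, ∑ p ∈ T, (redSigma p).factorization r := Finset.sum_comm
    _ ≤ _ := by
        refine Finset.sum_le_sum fun r hr => ?_
        exact ((Finset.sum_le_sum fun p _ => factorization_redSigma_le p r).trans
          (Finset.sum_le_sum_of_subset hT)).trans
          (sum_factorization_sigmaSq_le hN (ne_two_of_mem_targetPrimes hodd (hD hr)))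

lemma card_filter_mod_eq_one_le (hN : N.Perfect) :
    ({p ∈ sqPrimes N | p % 3 = 1} : Finset ℕ).card ≤ N.factorization 3 := by
  calc ({p ∈ sqPrimes N | p % 3 = 1} : Finset ℕ).card
      = ∑ p ∈ sqPrimes N with p % 3 = 1, 1 := by simp
    _ ≤ ∑ p ∈ sqPrimes N with p % 3 = 1, (sigmaSq p).factorization 3 := by
        refine Finset.sum_le_sum fun p hp => ?_
        exact (Nat.prime_three.dvd_iff_one_le_factorization (sigmaSq_pos p).ne').1
          (sigmaSq_mod_three_of_mod_eq_one (Finset.mem_filter.1 hp).2)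
    _ ≤ ∑ p ∈ sqPrimes N, (sigmaSq p).factorization 3 :=
        Finset.sum_le_sum_of_subset (Finset.filter_subset _ _)
    _ ≤ _ := sum_factorization_sigmaSq_le hN (by norm_num)

lemma properties_of_mem_sqPrimes (hodd : Odd N) {p : ℕ} (hp : p ∈ sqPrimes N) :
    p.Prime ∧ Odd p ∧ 5 ≤ p ∧ p % 3 ≠ 0 := by
  have h := mem_sqPrimes.1 hp
  have hpp := Nat.prime_of_mem_primeFactors h.1
  have ho := odd_of_mem_primeFactors hodd h.1
  exact ⟨hpp, ho, five_le_of_prime hpp ho h.2.1, mod_three_ne_zero_of_prime hpp h.2.1⟩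

lemma card_redSigmaPrimes (hodd : Odd N) :
    (redSigmaPrimes N).card = ({p ∈ sqPrimes N | (redSigma p).Prime} : Finset ℕ).card := by
  refine Finset.card_image_of_injOn fun x hx y hy hxy => ?_
  simp only [Finset.coe_filter, Set.mem_ofPred_eq] at hx hy
  obtain ⟨-, -, hx5, hx3⟩ := properties_of_mem_sqPrimes hodd hx.1
  obtain ⟨-, -, hy5, hy3⟩ := properties_of_mem_sqPrimes hodd hy.1
  exact redSigma_inj (by omega) (by omega) hx3 hy3 hx.2 hxy

lemma redSigmaPrimes_subset (hN : N.Perfect) : redSigmaPrimes N ⊆ targetPrimes N := by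
  intro r hr
  obtain ⟨p, hp, hpp, rfl⟩ := mem_redSigmaPrimes.1 hr
  exact mem_targetPrimes_of_dvd hN hp hpp dvd_rfl

lemma exists_primes_of_cardFactors_eq_two {n : ℕ}
    (h : ArithmeticFunction.cardFactors n = 2) : ∃ a b, a.Prime ∧ b.Prime ∧ n = a * b := by
  have hn : n ≠ 0 := by rintro rfl; simp at h
  rw [ArithmeticFunction.cardFactors_apply, List.length_eq_two] at h
  obtain ⟨a, b, hab⟩ := h
  refine ⟨a, b, Nat.prime_of_mem_primeFactorsList (n := n) (by simp [hab]),
    Nat.prime_of_mem_primeFactorsList (n := n) (by simp [hab]), ?_⟩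
  rw [← Nat.prod_primeFactorsList hn, hab]
  simp

lemma exists_primes_of_cardFactors_eq_three {n : ℕ}
    (h : ArithmeticFunction.cardFactors n = 3) :
    ∃ a b c, a.Prime ∧ b.Prime ∧ c.Prime ∧ n = a * b * c := by
  have hn : n ≠ 0 := by rintro rfl; simp at h
  rw [ArithmeticFunction.cardFactors_apply, List.length_eq_three] at h
  obtain ⟨a, b, c, hab⟩ := h
  refine ⟨a, b, c, Nat.prime_of_mem_primeFactorsList (n := n) (by simp [hab]),
    Nat.prime_of_mem_primeFactorsList (n := n) (by simp [hab]),
    Nat.prime_of_mem_primeFactorsList (n := n) (by simp [hab]), ?_⟩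
  rw [← Nat.prod_primeFactorsList hn, hab]
  simp [mul_assoc]

lemma exists_dvd_of_cardFactors_eq_two (hodd : Odd N) (hN : N.Perfect) {p : ℕ}
    (hp : p ∈ sqPrimes N) (h : ArithmeticFunction.cardFactors (redSigma p) = 2) :
    ∃ r ∈ targetPrimes N \ redSigmaPrimes N, r ∣ redSigma p := by
  by_contra! hcon
  have key (r : ℕ) (hr : r.Prime) (hd : r ∣ redSigma p) : r ∈ redSigmaPrimes N := by
    by_contra hr'
    exact hcon r (Finset.mem_sdiff.2 ⟨mem_targetPrimes_of_dvd hN hp hr hd, hr'⟩) hd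
  obtain ⟨a, b, ha, hb, hab⟩ := exists_primes_of_cardFactors_eq_two h
  obtain ⟨x, hx, hxp, rfl⟩ := mem_redSigmaPrimes.1 (key a ha ⟨b, hab⟩)
  obtain ⟨y, hy, hyp, rfl⟩ := mem_redSigmaPrimes.1 (key b hb ⟨redSigma x, by rw [hab]; ring⟩)
  obtain ⟨hpP, -, -, hp3⟩ := properties_of_mem_sqPrimes hodd hp
  obtain ⟨-, hxo, hx5, hx3⟩ := properties_of_mem_sqPrimes hodd hx
  obtain ⟨-, hyo, hy5, hy3⟩ := properties_of_mem_sqPrimes hodd hy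
  exact redSigma_ne_mul hpP hp3 hx5 hy5 hxo hyo hx3 hy3 hxp hyp hab

lemma exists_dvd_of_cardFactors_eq_three (hodd : Odd N) (hN : N.Perfect)
    (hS : ∀ p ∈ sqPrimes N, p % 3 = 2) {p : ℕ}
    (hp : p ∈ sqPrimes N) (h : ArithmeticFunction.cardFactors (redSigma p) = 3) :
    ∃ r ∈ targetPrimes N \ redSigmaPrimes N, r ∣ redSigma p := by
  by_contra! hcon
  have key (r : ℕ) (hr : r.Prime) (hd : r ∣ redSigma p) : r ∈ redSigmaPrimes N := by
    by_contra hr'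
    exact hcon r (Finset.mem_sdiff.2 ⟨mem_targetPrimes_of_dvd hN hp hr hd, hr'⟩) hd
  obtain ⟨a, b, c, ha, hb, hc, hab⟩ := exists_primes_of_cardFactors_eq_three h
  obtain ⟨x, hx, hxp, rfl⟩ := mem_redSigmaPrimes.1 (key a ha ⟨b * c, by rw [hab]; ring⟩)
  obtain ⟨y, hy, hyp, rfl⟩ := mem_redSigmaPrimes.1 (key b hb ⟨redSigma x * c, by rw [hab]; ring⟩)
  obtain ⟨z, hz, hzp, rfl⟩ := mem_redSigmaPrimes.1
    (key c hc ⟨redSigma x * redSigma y, by rw [hab]; ring⟩)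
  obtain ⟨hxP, -, hx5, -⟩ := properties_of_mem_sqPrimes hodd hx
  obtain ⟨hyP, -, hy5, -⟩ := properties_of_mem_sqPrimes hodd hy
  obtain ⟨hzP, -, hz5, -⟩ := properties_of_mem_sqPrimes hodd hz
  rw [← redSigma_of_two (hS x hx)] at hxp hab
  rw [← redSigma_of_two (hS y hy)] at hyp hab
  rw [← redSigma_of_two (hS z hz), ← redSigma_of_two (hS p hp)] at hab
  rw [← redSigma_of_two (hS z hz)] at hzp
  exact sigmaSq_ne_mul_mul (hS p hp) hxP hyP hzP (hS x hx) (hS y hy) (hS z hz) hx5 hy5 hz5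
    hxp hyp hzp hab

/-- With at most two prime factors, the larger is at least `√(sigmaSq p) > p`. -/
lemma exists_lt_prime_dvd {p : ℕ} (hp3 : p % 3 = 2)
    (h : ArithmeticFunction.cardFactors (redSigma p) = 1 ∨
      ArithmeticFunction.cardFactors (redSigma p) = 2) :
    ∃ r, r.Prime ∧ r ∣ redSigma p ∧ p < r := by
  rcases h with h | h
  · refine ⟨redSigma p, ArithmeticFunction.cardFactors_eq_one_iff_prime.1 h, dvd_rfl, ?_⟩
    rw [← redSigma_of_two hp3, sigmaSq]
    nlinarith
  · obtain ⟨a, b, ha, hb, hab⟩ := exists_primes_of_cardFactors_eq_two h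
    have hs := redSigma_of_two hp3
    rcases le_total a b with hle | hle
    · exact ⟨b, hb, ⟨a, by rw [hab]; ring⟩, lt_of_sigmaSq_le_sq (by rw [hs, hab]; nlinarith)⟩
    · exact ⟨a, ha, ⟨b, by rw [hab]⟩, lt_of_sigmaSq_le_sq (by rw [hs, hab]; nlinarith)⟩

lemma card_filter_cardFactors_le_two (hN : N.Perfect) :
    ({p ∈ sqPrimes N | p % 3 = 2 ∧ (ArithmeticFunction.cardFactors (redSigma p) = 1 ∨
      ArithmeticFunction.cardFactors (redSigma p) = 2)} : Finset ℕ).card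
      ≤ (targetPrimes N).card := by
  have h (p : ℕ) (hp : p ∈ ({p ∈ sqPrimes N | p % 3 = 2 ∧
      (ArithmeticFunction.cardFactors (redSigma p) = 1 ∨
      ArithmeticFunction.cardFactors (redSigma p) = 2)} : Finset ℕ)) :
      ∃ r, r.Prime ∧ r ∣ redSigma p ∧ p < r := by
    rw [Finset.mem_filter] at hp
    exact exists_lt_prime_dvd hp.2.1 hp.2.2
  choose! f hf using h
  refine Finset.card_le_card_of_injOn f (fun p hp => ?_) fun p hp q hq hpq => ?_
  · exact mem_targetPrimes_of_dvd hN (Finset.mem_filter.1 hp).1 (hf p hp).1 (hf p hp).2.1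
  · obtain ⟨hp1, hp2, hp4⟩ := hf p hp
    obtain ⟨-, hq2, hq4⟩ := hf q hq
    rw [← hpq] at hq2 hq4
    exact eq_of_prime_dvd_sigmaSq_of_lt hp1 (hp2.trans (redSigma_dvd p))
      (hq2.trans (redSigma_dvd q)) hp4 hq4 (Finset.mem_filter.1 hp).2.1 (Finset.mem_filter.1 hq).2.1

end OddPerfect

/-! ### Linear inequalities between the counts -/

section Counting

variable {N : ℕ}

/-- The elements `p` of `sqPrimes N` in the residue class `i` modulo `3` for which `redSigma p` has
exactly `k` prime factors. -/
def sqPrimesWith (N i k : ℕ) : Finset ℕ :=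
  {p ∈ sqPrimes N | p % 3 = i ∧ ArithmeticFunction.cardFactors (redSigma p) = k}

/-- As `sqPrimesWith`, for at least `k` prime factors. -/
def sqPrimesWithGE (N i k : ℕ) : Finset ℕ :=
  {p ∈ sqPrimes N | p % 3 = i ∧ k ≤ ArithmeticFunction.cardFactors (redSigma p)}

lemma one_le_cardFactors_redSigma (hodd : Odd N) {p : ℕ} (hp : p ∈ sqPrimes N) :
    1 ≤ ArithmeticFunction.cardFactors (redSigma p) := by
  obtain ⟨-, -, hp5, hp3⟩ := properties_of_mem_sqPrimes hodd hp
  refine ArithmeticFunction.cardFactors_pos_iff_one_lt.2 ?_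
  have h : p % 3 = 1 ∨ p % 3 = 2 := by omega
  rcases h with h | h
  · have := redSigma_of_one h
    unfold sigmaSq at this
    nlinarith
  · have := redSigma_of_two h
    unfold sigmaSq at this
    nlinarith

lemma card_filter_mod_eq_one (hodd : Odd N) :
    ({p ∈ sqPrimes N | p % 3 = 1} : Finset ℕ).card
      = (sqPrimesWith N 1 1).card + (sqPrimesWith N 1 2).card + (sqPrimesWithGE N 1 3).card := by
  simp only [sqPrimesWith, sqPrimesWithGE, Finset.card_filter, ← Finset.sum_add_distrib]
  refine Finset.sum_congr rfl fun p hp => ?_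
  have := one_le_cardFactors_redSigma hodd hp
  split_ifs <;> omega

lemma card_filter_mod_eq_two (hodd : Odd N) :
    ({p ∈ sqPrimes N | p % 3 = 2} : Finset ℕ).card
      = (sqPrimesWith N 2 1).card + (sqPrimesWith N 2 2).card + (sqPrimesWith N 2 3).card
        + (sqPrimesWithGE N 2 4).card := by
  simp only [sqPrimesWith, sqPrimesWithGE, Finset.card_filter, ← Finset.sum_add_distrib]
  refine Finset.sum_congr rfl fun p hp => ?_
  have := one_le_cardFactors_redSigma hodd hp
  split_ifs <;> omega

lemma weighted_card_le_sum_factorization (hodd : Odd N) (hN : N.Perfect) :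
    (sqPrimesWith N 2 1).card + 2 * (sqPrimesWith N 2 2).card + 3 * (sqPrimesWith N 2 3).card
        + 4 * (sqPrimesWithGE N 2 4).card + (sqPrimesWith N 1 1).card
        + 2 * (sqPrimesWith N 1 2).card + 3 * (sqPrimesWithGE N 1 3).card
      ≤ ∑ r ∈ targetPrimes N, N.factorization r := by
  refine le_trans ?_ (sum_cardFactors_redSigma_le hodd hN)
  simp only [sqPrimesWith, sqPrimesWithGE, Finset.card_filter, Finset.mul_sum,
    ← Finset.sum_add_distrib]
  refine Finset.sum_le_sum fun p _ => ?_
  split_ifs <;> omega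

lemma card_redSigmaPrimes_eq_add (hodd : Odd N) :
    (redSigmaPrimes N).card = (sqPrimesWith N 2 1).card + (sqPrimesWith N 1 1).card := by
  rw [card_redSigmaPrimes hodd]
  simp only [sqPrimesWith, Finset.card_filter, ← Finset.sum_add_distrib,
    ArithmeticFunction.cardFactors_eq_one_iff_prime]
  refine Finset.sum_congr rfl fun p hp => ?_
  obtain ⟨-, -, -, hp3⟩ := properties_of_mem_sqPrimes hodd hp
  have h : p % 3 = 1 ∨ p % 3 = 2 := by omega
  rcases h with h | h <;> simp [h]

lemma card_add_card_le_card_targetPrimes (hN : N.Perfect) :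
    (sqPrimesWith N 2 1).card + (sqPrimesWith N 2 2).card ≤ (targetPrimes N).card := by
  refine le_trans (le_of_eq ?_) (card_filter_cardFactors_le_two hN)
  simp only [sqPrimesWith, Finset.card_filter, ← Finset.sum_add_distrib]
  refine Finset.sum_congr rfl fun p _ => ?_
  split_ifs <;> omega

lemma card_add_card_le_sum_factorization (hodd : Odd N) (hN : N.Perfect) :
    (sqPrimesWith N 2 2).card + (sqPrimesWith N 1 2).card
      ≤ ∑ r ∈ targetPrimes N \ redSigmaPrimes N, N.factorization r := by
  refine le_trans ?_ (card_le_sum_of_exists_dvd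
    (T := {p ∈ sqPrimes N | ArithmeticFunction.cardFactors (redSigma p) = 2}) hodd hN
    (Finset.filter_subset _ _) Finset.sdiff_subset fun p hp => ?_)
  · simp only [sqPrimesWith, Finset.card_filter, ← Finset.sum_add_distrib]
    refine Finset.sum_le_sum fun p _ => ?_
    split_ifs <;> omega
  · rw [Finset.mem_filter] at hp
    exact exists_dvd_of_cardFactors_eq_two hodd hN hp.1 hp.2

lemma card_add_card_le_sum_factorization' (hodd : Odd N) (hN : N.Perfect)
    (hS : ∀ p ∈ sqPrimes N, p % 3 = 2) :
    (sqPrimesWith N 2 2).card + (sqPrimesWith N 2 3).card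
      ≤ ∑ r ∈ targetPrimes N \ redSigmaPrimes N, N.factorization r := by
  refine le_trans ?_ (card_le_sum_of_exists_dvd
    (T := {p ∈ sqPrimes N | ArithmeticFunction.cardFactors (redSigma p) = 2 ∨
      ArithmeticFunction.cardFactors (redSigma p) = 3}) hodd hN
    (Finset.filter_subset _ _) Finset.sdiff_subset fun p hp => ?_)
  · simp only [sqPrimesWith, Finset.card_filter, ← Finset.sum_add_distrib]
    refine Finset.sum_le_sum fun p _ => ?_
    split_ifs <;> omega
  · rw [Finset.mem_filter] at hp
    rcases hp.2 with h | h
    · exact exists_dvd_of_cardFactors_eq_two hodd hN hp.1 h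
    · exact exists_dvd_of_cardFactors_eq_three hodd hN hS hp.1 h

lemma filter_targetPrimes_factorization_eq_two :
    ({r ∈ targetPrimes N | N.factorization r = 2} : Finset ℕ)
      = {p ∈ sqPrimes N | p % 3 = 1} := by
  ext r
  simp only [Finset.mem_filter, mem_targetPrimes, mem_sqPrimes]
  constructor
  · rintro ⟨⟨h1, h2, h3⟩, h4⟩
    have := mod_three_ne_zero_of_prime (Nat.prime_of_mem_primeFactors h1) h2
    exact ⟨⟨h1, h2, h4⟩, by omega⟩
  · rintro ⟨⟨h1, h2, h3⟩, h4⟩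
    exact ⟨⟨h1, h2, by omega⟩, h3⟩

/-- An even exponent other than 2 is at least 4; an odd one may be as small as 1, a deficit of 3. -/
lemma four_mul_card_le_sum_factorization {D : Finset ℕ} (hD : D ⊆ targetPrimes N) :
    2 * ({r ∈ D | N.factorization r = 2} : Finset ℕ).card
      + 4 * ({r ∈ D | N.factorization r ≠ 2} : Finset ℕ).card
      ≤ ∑ r ∈ D, N.factorization r
        + 3 * ({r ∈ D | Odd (N.factorization r)} : Finset ℕ).card := by
  simp only [Finset.card_filter, Finset.mul_sum, ← Finset.sum_add_distrib]
  refine Finset.sum_le_sum fun r hr => ?_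
  have hrP := (mem_targetPrimes.1 (hD hr)).1
  have h1 : 1 ≤ N.factorization r :=
    ((Nat.prime_of_mem_primeFactors hrP).dvd_iff_one_le_factorization
      (Nat.mem_primeFactors.1 hrP).2.2).1 (Nat.dvd_of_mem_primeFactors hrP)
  have h2 := Nat.odd_iff (n := N.factorization r)
  split_ifs with h3 h4 h5 <;> rw [h2] at * <;> omega

lemma card_filter_odd_le_one (hodd : Odd N) (hN : N.Perfect) :
    ({r ∈ N.primeFactors | Odd (N.factorization r)} : Finset ℕ).card ≤ 1 := by
  refine Finset.card_le_one.2 fun p hp q hq => ?_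
  rw [Finset.mem_filter] at hp hq
  exact eq_of_odd_factorization hodd hN hp.1 hq.1 hp.2 hq.2

lemma cardFactors_eq_add :
    ArithmeticFunction.cardFactors N = N.factorization 3
      + 2 * ({p ∈ sqPrimes N | p % 3 = 2} : Finset ℕ).card
      + ∑ r ∈ targetPrimes N, N.factorization r := by
  have h3 : N.factorization 3 = ∑ p ∈ N.primeFactors, if p = 3 then N.factorization 3 else 0 := by
    rw [Finset.sum_ite_eq']
    split_ifs with h
    · rfl
    · rwa [← Nat.support_factorization, Finsupp.notMem_support_iff] at h
  rw [ArithmeticFunction.cardFactors_eq_sum_factorization, Finsupp.sum, Nat.support_factorization,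
    h3, sqPrimes, targetPrimes, Finset.filter_filter, Finset.card_filter, Finset.sum_filter,
    Finset.mul_sum, ← Finset.sum_add_distrib, ← Finset.sum_add_distrib]
  refine Finset.sum_congr rfl fun p _ => ?_
  by_cases hp : p = 3
  · subst hp
    simp
  · split_ifs <;> omega

lemma cardDistinctFactors_le_add :
    ArithmeticFunction.cardDistinctFactors N ≤ 1
      + ({p ∈ sqPrimes N | p % 3 = 2} : Finset ℕ).card + (targetPrimes N).card := by
  have h1 : ArithmeticFunction.cardDistinctFactors N = N.primeFactors.card := by
    rw [ArithmeticFunction.cardDistinctFactors_apply, Nat.primeFactors, List.card_toFinset]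
  have h3 : ∑ p ∈ N.primeFactors, (if p = 3 then 1 else 0) ≤ 1 := by
    rw [Finset.sum_ite_eq']
    split_ifs <;> omega
  rw [h1]
  refine le_trans ?_ (Nat.add_le_add_right (Nat.add_le_add_right h3 _) _)
  rw [sqPrimes, targetPrimes, Finset.filter_filter, Finset.card_filter, Finset.card_filter,
    Finset.card_eq_sum_ones, ← Finset.sum_add_distrib, ← Finset.sum_add_distrib]
  refine Finset.sum_le_sum fun p _ => ?_
  split_ifs <;> omega

lemma cardDistinctFactors_le_add_of_not_dvd (h3 : ¬ 3 ∣ N) :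
    ArithmeticFunction.cardDistinctFactors N ≤
      ({p ∈ sqPrimes N | p % 3 = 2} : Finset ℕ).card + (targetPrimes N).card := by
  rw [ArithmeticFunction.cardDistinctFactors_apply, ← List.card_toFinset, ← Nat.primeFactors,
    sqPrimes, targetPrimes, Finset.filter_filter, Finset.card_filter, Finset.card_filter,
    Finset.card_eq_sum_ones, ← Finset.sum_add_distrib]
  refine Finset.sum_le_sum fun p hp => ?_
  have : p ≠ 3 := by
    rintro rfl
    exact h3 (Nat.dvd_of_mem_primeFactors hp)
  split_ifs <;> omega

end Counting

/-! ### Combining the inequalities -/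

theorem mainTheorem1 (N : ℕ) (hodd : Odd N) (hperf : Nat.Perfect N) :
    (¬ 3 ∣ N →
      (302 / 113 : ℝ) * (ArithmeticFunction.cardDistinctFactors N : ℝ) - 286 / 113
        ≤ (ArithmeticFunction.cardFactors N : ℝ)) ∧
    (3 ∣ N →
      (66 / 25 : ℝ) * (ArithmeticFunction.cardDistinctFactors N : ℝ) - 5
        ≤ (ArithmeticFunction.cardFactors N : ℝ)) := by
  have hA := redSigmaPrimes_subset hperf
  have hu := card_filter_mod_eq_one hodd
  have hv := card_filter_mod_eq_two hodd
  have hu3 := card_filter_mod_eq_one_le hperf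
  have hw := weighted_card_le_sum_factorization hodd hperf
  have hAc := card_redSigmaPrimes_eq_add hodd
  have hbig := card_add_card_le_card_targetPrimes hperf
  have htwo := card_add_card_le_sum_factorization hodd hperf
  have hΩ := cardFactors_eq_add (N := N)
  have hUR := congrArg Finset.card (filter_targetPrimes_factorization_eq_two (N := N))
  have hDe := four_mul_card_le_sum_factorization
    (Finset.sdiff_subset (s := targetPrimes N) (t := redSigmaPrimes N))
  have hAe := four_mul_card_le_sum_factorization hA
  have hAs := Finset.card_filter_add_card_filter_not (s := redSigmaPrimes N)
    (fun r => N.factorization r = 2)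
  have hDs := Finset.card_filter_add_card_filter_not (s := targetPrimes N \ redSigmaPrimes N)
    (fun r => N.factorization r = 2)
  have hsum := Finset.sum_sdiff (f := fun r => N.factorization r) hA
  have hcard := Finset.card_sdiff_add_card_eq_card hA
  have hU : ({r ∈ targetPrimes N | N.factorization r = 2} : Finset ℕ).card
      = ({r ∈ targetPrimes N \ redSigmaPrimes N | N.factorization r = 2} : Finset ℕ).card
        + ({r ∈ redSigmaPrimes N | N.factorization r = 2} : Finset ℕ).card := by
    simp only [Finset.card_filter]
    exact (Finset.sum_sdiff hA).symm
  have hO : ({r ∈ targetPrimes N \ redSigmaPrimes N | Odd (N.factorization r)} : Finset ℕ).card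
      + ({r ∈ redSigmaPrimes N | Odd (N.factorization r)} : Finset ℕ).card ≤ 1 := by
    refine le_trans (le_of_eq ?_) ((Finset.card_le_card (Finset.filter_subset_filter
      (fun r => Odd (N.factorization r)) (Finset.filter_subset _ _ :
        targetPrimes N ⊆ N.primeFactors))).trans (card_filter_odd_le_one hodd hperf))
    simp only [Finset.card_filter]
    exact Finset.sum_sdiff hA
  simp only [ne_eq] at *
  constructor
  · intro h3
    have hω := cardDistinctFactors_le_add_of_not_dvd h3
    have hf : N.factorization 3 = 0 := Nat.factorization_eq_zero_of_not_dvd h3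
    have hS (p : ℕ) (hp : p ∈ sqPrimes N) : p % 3 = 2 := by
      obtain ⟨-, -, -, hp3⟩ := properties_of_mem_sqPrimes hodd hp
      rw [hf, Nat.le_zero, Finset.card_eq_zero, Finset.filter_eq_empty_iff] at hu3
      have := hu3 hp
      omega
    have hthree := card_add_card_le_sum_factorization' hodd hperf hS
    -- No target has exponent 2 here. Suitable multipliers are 22 for `hw` and `hbig`, 10 for
    -- `hthree`, 89 for `hAe`, 81 for `hDe`; an odd exponent costs at most `3 * 89 ≤ 286`.
    have key : 302 * ArithmeticFunction.cardDistinctFactors N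
        ≤ 113 * ArithmeticFunction.cardFactors N + 286 := by
      linarith
    have key' : (302 : ℝ) * ArithmeticFunction.cardDistinctFactors N
        ≤ 113 * ArithmeticFunction.cardFactors N + 286 := by exact_mod_cast key
    linarith
  · intro _
    have hω := cardDistinctFactors_le_add (N := N)
    -- Suitable multipliers are 25 for `hu3`, 6 for `hw`, 2 for `hbig` and `htwo`, 19 for `hAe`, 17
    -- for `hDe`. The constant 125 covers 66 for the prime 3 and at most `3 * 19` for an odd
    -- exponent.
    have key : 66 * ArithmeticFunction.cardDistinctFactors N
        ≤ 25 * ArithmeticFunction.cardFactors N + 125 := by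
      linarith
    have key' : (66 : ℝ) * ArithmeticFunction.cardDistinctFactors N
        ≤ 25 * ArithmeticFunction.cardFactors N + 125 := by exact_mod_cast key
    linarith
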